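/- For a finite group $G$, the coprime graph $\Gamma_G$ is the simple graph whose vertices are the elements of $G$, two distinct elements $x,y$ being adjacent if and only if their orders are coprime. Let $E_G$ be the set of all non-identity elements of $G$ that have degree one in $\Gamma_G$. **Theorem.** For a finite group $G$, $|E_G| = 4$ if and only if $G$ is isomorphic to one of the following six groups: $\mathbb{Z}_5$; $\mathbb{Z}_{10}$; $D_{20}$; $\mathrm{Dic}_{20}$; $GA(1,5)\times\mathbb{Z}_2$; $\langle a,b \mid a^5 = b^8 = e,\ bab^{-1} = a^2\rangle$. Here $\mathbb{Z}_n$ is the cyclic group of order $n$, $D_{20}$ is the dihedral group of order $20$, $\mathrm{Dic}_{20} = \langle a,x \mid a^{10} = e,\ x^2 = a^5,\ x^{-1}ax = a^{-1}\rangle$ is the dicyclic group of order $20$, and $GA(1,5)$ is the general affine group of degree $1$ over the field with $5$ elements, that is, the group under composition of all maps $t \mapsto ut+v$ on $\mathbb{F}_5$ with $u \in \mathbb{F}_5^{\times}$ and $v \in \mathbb{F}_5$. -/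

import Mathlib

/-- The coprime graph of a group: the vertices are the elements of `G`, and two distinct elements
are adjacent when their orders are coprime. -/
def coprimeGraph (G : Type*) [Group G] : SimpleGraph G where
  Adj x y := x ≠ y ∧ Nat.Coprime (orderOf x) (orderOf y)
  symm := ⟨fun _ _ h => ⟨h.1.symm, h.2.symm⟩⟩
  loopless := ⟨fun _ h => h.1 rfl⟩

/-- The non-identity end vertices (vertices with exactly one neighbour) of the coprime graph. -/
def endVertices (G : Type*) [Group G] : Set G :=
  {x | x ≠ 1 ∧ ((coprimeGraph G).neighborSet x).ncard = 1}

/-- The general affine group of degree one over `F`: the group, under composition, of all affine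
automorphisms of the affine line over `F`. -/
abbrev AffineGroupOne (F : Type*) [Ring F] : Type _ := F ≃ᵃ[F] F

/-- The relators `a ^ 5`, `b ^ 8` and `b * a * b⁻¹ * (a ^ 2)⁻¹`, where `a` and `b` are the two free
generators. -/
def metacyclicRelators : Set (FreeGroup (Fin 2)) :=
  {FreeGroup.of 0 ^ 5, FreeGroup.of 1 ^ 8,
    FreeGroup.of 1 * FreeGroup.of 0 * (FreeGroup.of 1)⁻¹ * (FreeGroup.of 0 ^ 2)⁻¹}

/-- The group with presentation `⟨a, b ∣ a ^ 5 = b ^ 8 = 1, b * a * b⁻¹ = a ^ 2⟩`. -/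
abbrev MetacyclicGroup : Type := PresentedGroup metacyclicRelators

/-!
A non-identity element `x` of a finite group `G` is adjacent to the identity in the coprime graph,
so it is an end vertex exactly when no other element has order prime to that of `x`, that is, by
Cauchy's theorem, when every prime divisor of `|G|` divides the order of `x`
(`mem_endVertices_iff`).

Suppose that there are four end vertices. If `|G|` has a single prime divisor, then every element
but the identity is an end vertex and `|G| = 5`. Otherwise the order `n` of an end vertex has at
least two prime divisors, and the generators of the cyclic group it spans are end vertices, so
`φ(n) ≤ 4` and `n` is `6`, `10` or `12`. The value `12` is impossible because a cyclic group of
order `12` also has elements of order `6`. All end vertices therefore have the same order. A group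
never has exactly four elements of order `6` (`ncard_setOf_orderOf_eq_six_ne_four`): such elements
`x`, `x⁻¹`, `y`, `y⁻¹` would commute, and a fifth one appears among their products.

There remains the case of four elements of order `10`, the generators of a subgroup `⟨x⟩`, which is
then normal and equal to its own centralizer (`SelfCentralizingTen`). Thus `G / ⟨x⟩` embeds in the
automorphism group of `⟨x⟩`, cyclic of order `4` and generated by the seventh power map. A fifth
power `b` of a preimage of a generator of the quotient satisfies `b * x * b⁻¹ = x ^ r` and
`b ^ k = x ^ s` with `s = 0` or `s = 5` (`MetacyclicPair`), which leaves five possibilities for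
`(r, k, s)` (`SelfCentralizingTen.exists_cases`). These parameters determine the group
(`MetacyclicPair.nonempty_mulEquiv`), they force exactly four end vertices
(`MetacyclicPair.ncard_endVertices`), and each of the remaining five groups realizes one of them.
-/

/-! ### End vertices of the coprime graph -/

theorem coprimeGraph_neighborSet {G : Type*} [Group G] {x : G} (hx : x ≠ 1) :
    (coprimeGraph G).neighborSet x = {y | Nat.Coprime (orderOf x) (orderOf y)} := by
  ext y
  simp only [SimpleGraph.mem_neighborSet, coprimeGraph, Set.mem_ofPred_eq, and_iff_right_iff_imp]
  rintro h rfl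
  rw [Nat.coprime_self, orderOf_eq_one_iff] at h
  exact hx h

/-- The identity is a neighbour of every other vertex, so an end vertex has no other one; by
Cauchy's theorem this says that its order is divisible by every prime that divides `|G|`. -/
theorem mem_endVertices_iff {G : Type*} [Group G] [Finite G] {x : G} :
    x ∈ endVertices G ↔ x ≠ 1 ∧ ∀ p : ℕ, p.Prime → p ∣ Nat.card G → p ∣ orderOf x := by
  simp only [endVertices, Set.mem_ofPred_eq, and_congr_right_iff]
  intro hx
  rw [coprimeGraph_neighborSet hx, Set.ncard_eq_one]
  constructor
  · rintro ⟨a, ha⟩ p hp hpG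
    have h1 : (1 : G) ∈ ({a} : Set G) := by rw [← ha]; simp
    obtain rfl : 1 = a := h1
    have := Fact.mk hp
    obtain ⟨y, hy⟩ := exists_prime_orderOf_dvd_card' p hpG
    by_contra hpx
    have hy1 : y ∈ ({1} : Set G) := by
      rw [← ha, Set.mem_ofPred_eq, hy]
      exact ((Nat.Prime.coprime_iff_not_dvd hp).2 hpx).symm
    obtain rfl : y = 1 := hy1
    exact hp.one_lt.ne (orderOf_one.symm.trans hy)
  · intro h
    refine ⟨1, Set.eq_singleton_iff_unique_mem.2 ⟨by simp, fun y hy => ?_⟩⟩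
    by_contra hy1
    obtain ⟨p, hp, hpy⟩ := Nat.exists_prime_and_dvd (mt orderOf_eq_one_iff.1 hy1)
    have hpx := h p hp (hpy.trans (orderOf_dvd_natCard y))
    exact hp.not_dvd_one (Nat.Coprime.gcd_eq_one hy ▸ Nat.dvd_gcd hpx hpy)

/-- If `|G|` has at most one prime divisor, then every element except the identity is an end
vertex. -/
theorem card_eq_of_ncard_endVertices_eq {G : Type*} [Group G] [Finite G] {m : ℕ}
    (h : ∀ p q : ℕ, p.Prime → q.Prime → p ∣ Nat.card G → q ∣ Nat.card G → p = q)
    (hE : (endVertices G).ncard = m) : Nat.card G = m + 1 := by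
  have hE' : endVertices G = {1}ᶜ := by
    ext x
    rw [mem_endVertices_iff, Set.mem_compl_singleton_iff, and_iff_left_iff_imp]
    intro hx p hp hpG
    obtain ⟨q, hq, hqx⟩ := Nat.exists_prime_and_dvd (mt orderOf_eq_one_iff.1 hx)
    rwa [h p q hp hq hpG (hqx.trans (orderOf_dvd_natCard x))]
  rw [hE', Set.ncard_compl, Set.ncard_singleton] at hE
  have := Nat.card_pos (α := G)
  omega

theorem ncard_endVertices_of_card_prime {G : Type*} [Group G] {p : ℕ} (hp : p.Prime)
    (hG : Nat.card G = p) : (endVertices G).ncard = p - 1 := by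
  have : Finite G := Nat.finite_of_card_ne_zero (hG ▸ hp.ne_zero)
  have := card_eq_of_ncard_endVertices_eq (G := G) (fun q r hq hr hqG hrG => by
    rw [hG] at hqG hrG
    rw [(Nat.prime_dvd_prime_iff_eq hq hp).1 hqG, (Nat.prime_dvd_prime_iff_eq hr hp).1 hrG]) rfl
  omega

/-! ### Metacyclic groups with a distinguished cyclic subgroup of order ten -/

theorem conj_pow_pow {G : Type*} [Group G] {x b : G} {r : ℕ} (h : b * x * b⁻¹ = x ^ r) (n i : ℕ) :
    b ^ n * x ^ i * (b ^ n)⁻¹ = x ^ (i * r ^ n) := by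
  induction n generalizing i with
  | zero => simp
  | succ n ih =>
    have h1 : b * x ^ i * b⁻¹ = x ^ (r * i) := by rw [← conj_pow, h, pow_mul]
    calc b ^ (n + 1) * x ^ i * (b ^ (n + 1))⁻¹ = b ^ n * (b * x ^ i * b⁻¹) * (b ^ n)⁻¹ := by group
      _ = x ^ (i * r ^ (n + 1)) := by rw [h1, ih]; congr 1; ring

/-- `MetacyclicPair x b r k s` says that the group is generated by an element `x` of order `10` and
an element `b` with `b * x * b⁻¹ = x ^ r` and `b ^ k = x ^ s`, where `k` is the order of `r` modulo
`10`. Hence `⟨x⟩` is normal and equal to its own centralizer, and the quotient by it is cyclic of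
order `k`. -/
structure MetacyclicPair {G : Type*} [Group G] (x b : G) (r k s : ℕ) : Prop where
  orderOf_eq : orderOf x = 10
  conj_eq : b * x * b⁻¹ = x ^ r
  pow_eq : b ^ k = x ^ s
  closure_eq : Subgroup.closure {x, b} = ⊤
  orderOf_exponent : orderOf (r : ZMod 10) = k
  exponent_pos : 0 < k

theorem exists_eq_pow_mul_pow {G : Type*} [Group G] {x b : G} {r k s : ℕ} (hx : x ^ 10 = 1)
    (hb : b * x * b⁻¹ = x ^ r) (hk : b ^ k = x ^ s) (hk0 : 0 < k) {g : G}
    (hg : g ∈ Subgroup.closure {x, b}) : ∃ i j : ℕ, g = x ^ i * b ^ j := by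
  have hbpow : ∀ n : ℕ, ∀ y : G, (∃ i j : ℕ, y = x ^ i * b ^ j) →
      ∃ i j : ℕ, b ^ n * y = x ^ i * b ^ j := by
    rintro n _ ⟨i, j, rfl⟩
    refine ⟨i * r ^ n, n + j, ?_⟩
    rw [← conj_pow_pow hb, pow_add]
    group
  -- Both generators have finite order, so inverses may be replaced by natural powers.
  have hbinv : b⁻¹ = b ^ (k * 10 - 1) := by
    rw [inv_eq_iff_mul_eq_one, ← pow_succ', Nat.sub_add_cancel (by omega), pow_mul, hk, ← pow_mul,
      mul_comm, pow_mul, hx, one_pow]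
  have hxinv : x⁻¹ = x ^ 9 := by rw [inv_eq_iff_mul_eq_one, ← pow_succ', hx]
  induction hg using Subgroup.closure_induction_left with
  | one => exact ⟨0, 0, by simp⟩
  | mul_left y hy z _ ih =>
    rcases hy with rfl | rfl
    · obtain ⟨i, j, rfl⟩ := ih
      exact ⟨i + 1, j, by rw [pow_succ', mul_assoc]⟩
    · simpa using hbpow 1 z ih
  | inv_mul_cancel y hy z _ ih =>
    rcases hy with rfl | rfl
    · obtain ⟨i, j, rfl⟩ := ih
      exact ⟨9 + i, j, by rw [hxinv, pow_add, mul_assoc]⟩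
    · rw [hbinv]
      exact hbpow _ z ih

namespace MetacyclicPair

variable {G H : Type*} [Group G] [Group H] {x b : G} {y c : H} {r k s : ℕ}

theorem exists_eq (h : MetacyclicPair x b r k s) (g : G) : ∃ i j : ℕ, g = x ^ i * b ^ j :=
  exists_eq_pow_mul_pow (orderOf_dvd_iff_pow_eq_one.1 h.orderOf_eq.dvd) h.conj_eq h.pow_eq
    h.exponent_pos (h.closure_eq ▸ Subgroup.mem_top g)

theorem pow_eq_pow_iff (h : MetacyclicPair x b r k s) {m n : ℕ} :
    x ^ m = x ^ n ↔ (m : ZMod 10) = n := by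
  rw [pow_eq_pow_iff_modEq, h.orderOf_eq, ZMod.natCast_eq_natCast_iff]

/-- A power of `b` commutes with `x` only if it lies in `⟨x⟩`. -/
theorem dvd_of_commute (h : MetacyclicPair x b r k s) {i j : ℕ}
    (hc : Commute (x ^ i * b ^ j) x) : k ∣ j := by
  have hbj : Commute (b ^ j) x := by
    have := ((Commute.refl x).pow_left i).inv_left.mul_left hc
    rwa [inv_mul_cancel_left] at this
  have h1 : x ^ (1 * r ^ j) = x ^ 1 := by
    rw [← conj_pow_pow h.conj_eq, pow_one, hbj.eq, mul_inv_cancel_right]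
  rw [h.pow_eq_pow_iff, one_mul, Nat.cast_pow, Nat.cast_one, ← orderOf_dvd_iff_pow_eq_one,
    h.orderOf_exponent] at h1
  exact h1

theorem mem_zpowers_of_commute (h : MetacyclicPair x b r k s) {g : G} (hg : Commute g x) :
    ∃ m : ℕ, g = x ^ m := by
  obtain ⟨i, j, rfl⟩ := h.exists_eq g
  obtain ⟨m, rfl⟩ := h.dvd_of_commute hg
  exact ⟨i + s * m, by rw [pow_mul, h.pow_eq, ← pow_mul, pow_add]⟩

theorem conj_mem (h : MetacyclicPair x b r k s) (g : G) : ∃ j : ℕ, g * x * g⁻¹ = x ^ (r ^ j) := by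
  obtain ⟨i, j, rfl⟩ := h.exists_eq g
  refine ⟨j, ?_⟩
  have h1 := conj_pow_pow h.conj_eq j 1
  rw [pow_one, one_mul] at h1
  calc x ^ i * b ^ j * x * (x ^ i * b ^ j)⁻¹ = x ^ i * (b ^ j * x * (b ^ j)⁻¹) * (x ^ i)⁻¹ := by
        group
    _ = x ^ (r ^ j) := by rw [h1]; group

theorem map (h : MetacyclicPair x b r k s) (e : G ≃* H) : MetacyclicPair (e x) (e b) r k s where
  orderOf_eq := by rw [MulEquiv.orderOf_eq, h.orderOf_eq]
  conj_eq := by rw [← map_inv, ← map_mul, ← map_mul, h.conj_eq, map_pow]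
  pow_eq := by rw [← map_pow, h.pow_eq, map_pow]
  closure_eq := by
    have h1 := MonoidHom.map_closure e.toMonoidHom {x, b}
    rw [h.closure_eq, Subgroup.map_top_of_surjective _ e.surjective, Set.image_pair] at h1
    exact h1.symm
  orderOf_exponent := h.orderOf_exponent
  exponent_pos := h.exponent_pos

/-- In the subgroup of `G × H` generated by `(x, y)` and `(b, c)`, an element is determined by its
first coordinate. -/
theorem snd_eq_one (h : MetacyclicPair x b r k s) (h' : MetacyclicPair y c r k s) {p : G × H}
    (hp : p ∈ Subgroup.closure {(x, y), (b, c)}) (hp1 : p.1 = 1) : p.2 = 1 := by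
  obtain ⟨i, j, rfl⟩ := exists_eq_pow_mul_pow (r := r) (k := k) (s := s)
    (Prod.ext (orderOf_dvd_iff_pow_eq_one.1 h.orderOf_eq.dvd)
      (orderOf_dvd_iff_pow_eq_one.1 h'.orderOf_eq.dvd))
    (Prod.ext h.conj_eq h'.conj_eq) (Prod.ext h.pow_eq h'.pow_eq) h.exponent_pos hp
  simp only [Prod.fst_mul, Prod.pow_fst, Prod.snd_mul, Prod.pow_snd] at hp1 ⊢
  obtain ⟨m, rfl⟩ := h.dvd_of_commute (hp1 ▸ Commute.one_left x)
  rw [pow_mul, h.pow_eq, ← pow_mul, ← pow_add, ← pow_zero x, h.pow_eq_pow_iff,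
    ← h'.pow_eq_pow_iff, pow_zero] at hp1
  rwa [pow_mul, h'.pow_eq, ← pow_mul, ← pow_add]

theorem exists_mem_closure (h : MetacyclicPair x b r k s) (g : G) :
    ∃ z : H, (g, z) ∈ Subgroup.closure {(x, y), (b, c)} := by
  have h1 := MonoidHom.map_closure (MonoidHom.fst G H) {(x, y), (b, c)}
  rw [Set.image_pair, MonoidHom.coe_fst, h.closure_eq] at h1
  obtain ⟨⟨g', z⟩, hz, rfl⟩ := h1 ▸ Subgroup.mem_top g
  exact ⟨z, hz⟩

/-- The parameters `r`, `k` and `s` determine the group: the subgroup of `G × H` generated by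
`(x, y)` and `(b, c)` is the graph of an isomorphism. -/
theorem nonempty_mulEquiv (h : MetacyclicPair x b r k s) (h' : MetacyclicPair y c r k s) :
    Nonempty (G ≃* H) := by
  let K : Subgroup (G × H) := Subgroup.closure {(x, y), (b, c)}
  have hswap : ∀ p ∈ K, p.swap ∈ Subgroup.closure {(y, x), (c, b)} := by
    intro p hp
    have h1 := MonoidHom.map_closure (MulEquiv.prodComm (M := G) (N := H)).toMonoidHom
      {(x, y), (b, c)}
    rw [Set.image_pair] at h1
    exact h1 ▸ Subgroup.mem_map_of_mem _ hp
  have e1 : Function.Bijective ((MonoidHom.fst G H).comp K.subtype) := by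
    refine ⟨(injective_iff_map_eq_one _).2 fun p hp => ?_, fun g => ?_⟩
    · exact Subtype.ext (Prod.ext hp (h.snd_eq_one h' p.2 hp))
    · obtain ⟨z, hz⟩ := h.exists_mem_closure (y := y) (c := c) g
      exact ⟨⟨(g, z), hz⟩, rfl⟩
  have e2 : Function.Bijective ((MonoidHom.snd G H).comp K.subtype) := by
    refine ⟨(injective_iff_map_eq_one _).2 fun p hp => ?_, fun z => ?_⟩
    · exact Subtype.ext (Prod.ext (h'.snd_eq_one h (hswap p.1 p.2) hp) hp)
    · obtain ⟨g, hg⟩ := h'.exists_mem_closure (y := x) (c := b) z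
      have h1 := MonoidHom.map_closure (MulEquiv.prodComm (M := H) (N := G)).toMonoidHom
        {(y, x), (c, b)}
      rw [Set.image_pair] at h1
      have h2 : (g, z) ∈ K := by
        change (g, z) ∈ Subgroup.closure {(x, y), (b, c)}
        exact h1.le (Subgroup.mem_map_of_mem _ hg)
      exact ⟨⟨(g, z), h2⟩, rfl⟩
  exact ⟨(MulEquiv.ofBijective _ e1).symm.trans (MulEquiv.ofBijective _ e2)⟩

end MetacyclicPair

theorem pow_mem_generators_of_ten_dvd_orderOf {G : Type*} [Group G] {x : G} (hx : orderOf x = 10)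
    {m : ℕ}
    (h : 10 ∣ orderOf (x ^ m)) : x ^ m ∈ ({x, x ^ 3, x ^ 7, x ^ 9} : Set G) := by
  rw [← pow_mod_orderOf x m, hx] at h ⊢
  have hm : m % 10 < 10 := Nat.mod_lt _ (by norm_num)
  generalize m % 10 = n at h hm ⊢
  have h2 : ∀ d, d ≠ 0 → 10 ∣ n * d → 10 ∣ d := by
    intro d _ hd
    refine h.trans (orderOf_dvd_of_pow_eq_one ?_)
    rw [← pow_mul]
    exact orderOf_dvd_iff_pow_eq_one.1 (hx ▸ hd)
  have h3 := h2 2 (by norm_num)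
  have h4 := h2 5 (by norm_num)
  interval_cases n <;> first | omega | simp

theorem ncard_generators_of_orderOf_eq_ten {G : Type*} [Group G] {x : G} (hx : orderOf x = 10) :
    ({x, x ^ 3, x ^ 7, x ^ 9} : Set G).ncard = 4 := by
  have h1 : ({x, x ^ 3, x ^ 7, x ^ 9} : Set G) =
      (fun n => x ^ n) '' (({1, 3, 7, 9} : Finset ℕ) : Set ℕ) := by
    simp [Set.image_insert_eq]
  have hinj : Set.InjOn (fun n => x ^ n) (({1, 3, 7, 9} : Finset ℕ) : Set ℕ) := by
    refine pow_injOn_Iio_orderOf.mono fun n hn => ?_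
    simp only [Finset.coe_insert, Finset.coe_singleton, Set.mem_insert_iff,
      Set.mem_singleton_iff] at hn
    rw [Set.mem_Iio, hx]
    omega
  rw [h1, hinj.ncard_image, Set.ncard_coe_finset]
  rfl

theorem MetacyclicPair.ncard_endVertices {G : Type*} [Group G] [Finite G] {x b : G} {r k s : ℕ}
    (h : MetacyclicPair x b r k s) : (endVertices G).ncard = 4 := by
  have hunit : IsUnit (r : ZMod 10) := by
    have := h.orderOf_exponent ▸ h.exponent_pos
    exact IsOfFinOrder.isUnit (orderOf_pos_iff.1 this)
  have hr4 : ∀ u : ZMod 10, IsUnit u → u ^ 4 = 1 ∧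
      (u ≠ 1 → ∀ m : ZMod 10, m * u = m → 2 * m = 0) := by decide
  have hx10 : x ^ 10 = 1 := orderOf_dvd_iff_pow_eq_one.1 h.orderOf_eq.dvd
  -- The automorphism group of `⟨x⟩` has exponent `4`.
  have h4 : ∀ g : G, ∃ m : ℕ, g ^ 4 = x ^ m := by
    intro g
    obtain ⟨j, hj⟩ := h.conj_mem g
    refine h.mem_zpowers_of_commute ?_
    have h1 := conj_pow_pow hj 4 1
    have h2 : x ^ (1 * (r ^ j) ^ 4) = x ^ 1 := by
      rw [h.pow_eq_pow_iff]
      push_cast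
      rw [one_mul, (hr4 _ (hunit.pow j)).1]
    rw [h2, pow_one, mul_inv_eq_iff_eq_mul] at h1
    exact h1
  have hcard : ∀ p : ℕ, p.Prime → p ∣ Nat.card G → p = 2 ∨ p = 5 := by
    intro p hp hpG
    have := Fact.mk hp
    obtain ⟨g, hg⟩ := exists_prime_orderOf_dvd_card' p hpG
    obtain ⟨m, hm⟩ := h4 g
    have h40 : p ∣ 2 ^ 3 * 5 := hg ▸ orderOf_dvd_of_pow_eq_one (by
      rw [show 2 ^ 3 * 5 = 4 * 10 from rfl, pow_mul, hm, ← pow_mul, mul_comm, pow_mul, hx10,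
        one_pow])
    rcases (Nat.Prime.dvd_mul hp).1 h40 with h2 | h5
    · exact Or.inl ((Nat.prime_dvd_prime_iff_eq hp Nat.prime_two).1 (hp.dvd_of_dvd_pow h2))
    · exact Or.inr ((Nat.prime_dvd_prime_iff_eq hp Nat.prime_five).1 h5)
  have hmem : ∀ g, g ∈ endVertices G ↔ 10 ∣ orderOf g := by
    intro g
    rw [mem_endVertices_iff]
    constructor
    · rintro ⟨-, hg⟩
      have h10 : 10 ∣ Nat.card G := h.orderOf_eq ▸ orderOf_dvd_natCard x
      exact Nat.Coprime.mul_dvd_of_dvd_of_dvd (by norm_num : Nat.Coprime 2 5)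
        (hg 2 Nat.prime_two (dvd_trans (by norm_num) h10))
        (hg 5 Nat.prime_five (dvd_trans (by norm_num) h10))
    · intro hg
      refine ⟨?_, fun p hp hpG => dvd_trans ?_ hg⟩
      · rintro rfl
        simp at hg
      · rcases hcard p hp hpG with rfl | rfl <;> norm_num
  rw [← ncard_generators_of_orderOf_eq_ten h.orderOf_eq]
  congr 1
  ext g
  rw [hmem]
  constructor
  · intro hg
    obtain ⟨j, hj⟩ := h.conj_mem g
    obtain ⟨m, hm⟩ := h4 g
    by_cases hu : ((r : ZMod 10) ^ j) = 1
    · have h2 : x ^ (r ^ j) = x ^ 1 := by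
        rw [h.pow_eq_pow_iff]
        push_cast
        exact hu
      rw [h2, pow_one, mul_inv_eq_iff_eq_mul] at hj
      obtain ⟨i, rfl⟩ := h.mem_zpowers_of_commute (g := g) hj
      exact pow_mem_generators_of_ten_dvd_orderOf h.orderOf_eq hg
    · -- `g` commutes with its power `x ^ m`, and so `5 ∣ m`; hence the order of `g` divides `8`.
      exfalso
      have h1 := conj_pow_pow hj 1 m
      rw [pow_one, pow_one, ← hm, (Commute.self_pow g 4).eq, mul_inv_cancel_right, hm,
        h.pow_eq_pow_iff] at h1
      push_cast at h1
      have h5 := (hr4 _ (hunit.pow j)).2 hu m h1.symm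
      have h8 : g ^ 8 = 1 := by
        rw [show 8 = 4 * 2 from rfl, pow_mul, hm, ← pow_mul, ← pow_zero x, h.pow_eq_pow_iff]
        push_cast
        rw [mul_comm, h5]
      have := hg.trans (orderOf_dvd_of_pow_eq_one h8)
      omega
  · have hpow : ∀ n : ℕ, Nat.Coprime 10 n → 10 ∣ orderOf (x ^ n) := by
      intro n hn
      rw [Nat.Coprime.orderOf_pow (h.orderOf_eq ▸ hn), h.orderOf_eq]
    rintro (rfl | rfl | rfl | rfl)
    · exact h.orderOf_eq.symm.dvd
    all_goals exact hpow _ (by norm_num)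

/-! ### The orders of the end vertices -/

theorem eq_of_totient_le_four {n p q : ℕ} (hn : n ≠ 0) (hp : p.Prime) (hq : q.Prime)
    (hpq : p ≠ q) (hpn : p ∣ n) (hqn : q ∣ n) (h : n.totient ≤ 4) : n = 6 ∨ n = 10 ∨ n = 12 := by
  have key : ∀ d, d ∣ n → d.totient ≤ 4 := fun d hd =>
    (Nat.le_of_dvd (Nat.totient_pos.2 (Nat.pos_of_ne_zero hn))
      (Nat.totient_dvd_of_dvd hd)).trans h
  have hprime : ∀ r, r.Prime → r ∣ n → r = 2 ∨ r = 3 ∨ r = 5 := by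
    intro r hr hrn
    have h1 := key r hrn
    rw [Nat.totient_prime hr] at h1
    have h2 : r ≤ 5 := by omega
    have h3 := hr.two_le
    interval_cases r
    · simp
    · simp
    · exact absurd hr (by norm_num)
    · simp
  -- A proper multiple of `d` that divides `n` involves a further prime `2`, `3` or `5`.
  have hstep : ∀ d, 0 < d → d ∣ n → n = d ∨ d * 2 ∣ n ∨ d * 3 ∣ n ∨ d * 5 ∣ n := by
    rintro d hd ⟨m, rfl⟩
    by_cases hm : m = 1
    · simp [hm]
    · obtain ⟨r, hr, hrm⟩ := Nat.exists_prime_and_dvd hm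
      rcases hprime r hr (hrm.mul_left d) with rfl | rfl | rfl
      · exact Or.inr (Or.inl (mul_dvd_mul_left d hrm))
      · exact Or.inr (Or.inr (Or.inl (mul_dvd_mul_left d hrm)))
      · exact Or.inr (Or.inr (Or.inr (mul_dvd_mul_left d hrm)))
  have no : ∀ d, 4 < d.totient → ¬ d ∣ n := fun d hd hdn => by
    have := key d hdn
    omega
  have h15 := no 15 (by decide)
  have h18 := no 18 (by decide)
  have h30 := no 30 (by decide)
  have h20 := no 20 (by decide)
  have h50 := no 50 (by decide)
  have h24 := no 24 (by decide)
  have h36 := no 36 (by decide)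
  have h60 := no 60 (by decide)
  have h6 := hstep 6 (by norm_num)
  have h10 := hstep 10 (by norm_num)
  have h12 := hstep 12 (by norm_num)
  have hpq' := Nat.Coprime.mul_dvd_of_dvd_of_dvd ((Nat.coprime_primes hp hq).2 hpq) hpn hqn
  norm_num at h6 h10 h12
  rcases hprime p hp hpn with rfl | rfl | rfl <;> rcases hprime q hq hqn with rfl | rfl | rfl <;>
    first | exact absurd rfl hpq | (norm_num at hpq'; tauto)

/-- The powers of an end vertex `x` by exponents prime to its order are end vertices. -/
theorem totient_orderOf_le_ncard_endVertices {G : Type*} [Group G] [Finite G] {x : G}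
    (hx : x ∈ endVertices G) : (orderOf x).totient ≤ (endVertices G).ncard := by
  let S : Finset ℕ := (Finset.range (orderOf x)).filter (orderOf x).Coprime
  have hS : S.card = (orderOf x).totient := rfl
  have hinj : Set.InjOn (fun n => x ^ n) (S : Set ℕ) := by
    refine pow_injOn_Iio_orderOf.mono fun n hn => ?_
    exact Finset.mem_range.1 (Finset.mem_filter.1 hn).1
  rw [← hS, ← Set.ncard_coe_finset, ← hinj.ncard_image]
  refine Set.ncard_le_ncard ?_
  rintro _ ⟨n, hn, rfl⟩
  have ho : orderOf (x ^ n) = orderOf x := Nat.Coprime.orderOf_pow (Finset.mem_filter.1 hn).2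
  rw [mem_endVertices_iff] at hx ⊢
  refine ⟨fun h => hx.1 ?_, fun p hp hpG => ho ▸ hx.2 p hp hpG⟩
  rwa [← orderOf_eq_one_iff, ho, orderOf_eq_one_iff] at h

theorem orderOf_ne_twelve {G : Type*} [Group G] [Finite G] (hE : (endVertices G).ncard = 4)
    {x : G} (hx : x ∈ endVertices G) : orderOf x ≠ 12 := by
  intro ho
  -- Besides the four generators of `⟨x⟩`, the square of `x`, of order `6`, is an end vertex.
  let S : Finset ℕ := {1, 2, 5, 7, 11}
  have hlt : ∀ n ∈ S, n < 12 := by decide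
  have hinj : Set.InjOn (fun n => x ^ n) (S : Set ℕ) :=
    pow_injOn_Iio_orderOf.mono fun n hn => Set.mem_Iio.2 (ho ▸ hlt n hn)
  have hsub : (fun n => x ^ n) '' (S : Set ℕ) ⊆ endVertices G := by
    rintro _ ⟨n, hn, rfl⟩
    have h6 : 6 ∣ orderOf (x ^ n) := by
      rw [orderOf_pow, ho]
      exact (by decide : ∀ n ∈ S, 6 ∣ 12 / Nat.gcd 12 n) n hn
    rw [mem_endVertices_iff] at hx ⊢
    refine ⟨fun h => ?_, fun p hp hpG => dvd_trans ?_ h6⟩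
    · change x ^ n = 1 at h
      simp [h] at h6
    · have h12 := hx.2 p hp hpG
      rw [ho, show 12 = 2 * 6 from rfl] at h12
      rcases (Nat.Prime.dvd_mul hp).1 h12 with h2 | h2
      · exact h2.trans (by norm_num)
      · exact h2
  have := Set.ncard_le_ncard hsub
  rw [hinj.ncard_image, Set.ncard_coe_finset, hE] at this
  exact absurd this (by decide)

/-! ### There are never exactly four elements of order six -/

theorem ncard_setOf_orderOf_eq_six_ne_four {G : Type*} [Group G] [Finite G] :
    {g : G | orderOf g = 6}.ncard ≠ 4 := by
  intro hcard
  obtain ⟨x, hx⟩ : {g : G | orderOf g = 6}.Nonempty :=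
    Set.nonempty_of_ncard_ne_zero (by rw [hcard]; norm_num)
  have hpow5 : ∀ g : G, orderOf g = 6 → orderOf (g ^ 5) = 6 := fun g hg => by
    rw [Nat.Coprime.orderOf_pow (hg ▸ by norm_num), hg]
  have hlt : ({x, x ^ 5} : Set G).ncard < {g : G | orderOf g = 6}.ncard :=
    (Set.ncard_insert_le _ _).trans_lt (by rw [Set.ncard_singleton, hcard]; norm_num)
  obtain ⟨y, hy, hyx⟩ := Set.exists_mem_notMem_of_ncard_lt_ncard hlt
  simp only [Set.mem_insert_iff, Set.mem_singleton_iff, not_or] at hyx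
  replace hx : orderOf x = 6 := hx
  replace hy : orderOf y = 6 := hy
  have hmod : ∀ g : G, orderOf g = 6 → ∀ m n : ℕ, m ≡ n [MOD 6] → g ^ m = g ^ n :=
    fun g hg m n h => pow_eq_pow_iff_modEq.2 (hg.symm ▸ h)
  have hne5 : ∀ g : G, orderOf g = 6 → g ≠ g ^ 5 := fun g hg h => by
    have h15 : 1 ≡ 5 [MOD orderOf g] := pow_eq_pow_iff_modEq.1 (by rwa [pow_one])
    rw [hg] at h15
    exact absurd h15 (by decide)
  have h25 : ∀ g : G, orderOf g = 6 → (g ^ 5) ^ 5 = g := fun g hg => by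
    rw [← pow_mul]
    exact (hmod g hg 25 1 (by decide)).trans (pow_one g)
  have hset : ∀ g : G, orderOf g = 6 → g = x ∨ g = x ^ 5 ∨ g = y ∨ g = y ^ 5 := by
    have h1 : ({x, x ^ 5, y, y ^ 5} : Set G) = {g : G | orderOf g = 6} := by
      refine Set.eq_of_subset_of_ncard_le ?_ ?_
      · rintro g (rfl | rfl | rfl | rfl)
        exacts [hx, hpow5 _ hx, hy, hpow5 _ hy]
      · have h2 : x ≠ y ^ 5 := fun h => hyx.2 (by rw [h, h25 y hy])
        have h3 : x ^ 5 ≠ y ^ 5 := fun h => hyx.1 (by rw [← h25 y hy, ← h, h25 x hx])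
        rw [hcard, Set.ncard_insert_of_notMem, Set.ncard_insert_of_notMem, Set.ncard_pair]
        · exact hne5 y hy
        · simp only [Set.mem_insert_iff, Set.mem_singleton_iff, not_or]
          exact ⟨fun h => hyx.2 h.symm, h3⟩
        · simp only [Set.mem_insert_iff, Set.mem_singleton_iff, not_or]
          exact ⟨hne5 x hx, fun h => hyx.1 h.symm, h2⟩
    intro g hg
    have h2 : g ∈ ({x, x ^ 5, y, y ^ 5} : Set G) := h1 ▸ hg
    simpa using h2
  -- Conjugation by `u` permutes the four elements and fixes `u`, so it sends `v` to `v` or `v ^ 5`.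
  -- The cube of `v` is fixed in both cases, and the square of `u`, having odd order, fixes `v`.
  have hconj : ∀ u v : G, u * v * u⁻¹ = v ∨ u * v * u⁻¹ = v ^ 5 → orderOf u = 6 → orderOf v = 6 →
      Commute u (v ^ 3) ∧ Commute (u ^ 2) v := by
    intro u v h hu hv
    obtain ⟨c, hc, hc3, hc2⟩ : ∃ c : ℕ, u * v * u⁻¹ = v ^ c ∧ 3 * c ≡ 3 [MOD 6] ∧
        1 * c ^ 2 ≡ 1 [MOD 6] := by
      rcases h with h | h
      · exact ⟨1, by rwa [pow_one], by decide, by decide⟩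
      · exact ⟨5, h, by decide, by decide⟩
    have h1 := conj_pow_pow hc 1 3
    have h2 := conj_pow_pow hc 2 1
    rw [pow_one, pow_one, hmod v hv _ _ hc3, mul_inv_eq_iff_eq_mul] at h1
    rw [hmod v hv _ _ hc2, pow_one, mul_inv_eq_iff_eq_mul] at h2
    exact ⟨h1, h2⟩
  have hord : ∀ u v : G, orderOf v = 6 → orderOf (u * v * u⁻¹) = 6 := fun u v hv => by
    rw [← hv]
    exact (MulAut.conj u).orderOf_eq v
  have hxy : x * y * x⁻¹ = y ∨ x * y * x⁻¹ = y ^ 5 := by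
    rcases hset _ (hord x y hy) with h | h | h | h
    · rw [mul_inv_eq_iff_eq_mul, mul_right_inj] at h
      exact absurd h hyx.1
    · rw [mul_inv_eq_iff_eq_mul, ← pow_succ, pow_succ', mul_right_inj] at h
      exact absurd h hyx.2
    · exact Or.inl h
    · exact Or.inr h
  have hyx' : y * x * y⁻¹ = x ∨ y * x * y⁻¹ = x ^ 5 := by
    rcases hset _ (hord y x hx) with h | h | h | h
    · exact Or.inl h
    · exact Or.inr h
    · rw [mul_inv_eq_iff_eq_mul, mul_right_inj] at h
      exact absurd h.symm hyx.1
    · rw [mul_inv_eq_iff_eq_mul, ← pow_succ, pow_succ', mul_right_inj] at h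
      exact absurd (by rw [h, h25 y hy]) hyx.2
  have hcomm : Commute x y := by
    have h3 := (hconj x y hxy hx hy).1
    have h2 := (hconj y x hyx' hy hx).2.symm
    have h1 := h3.mul_right (h2.mul_right h2)
    rwa [← pow_add, ← pow_add, hmod y hy _ 1 (by decide), pow_one] at h1
  have hmul : ∀ a b n : ℕ, (x ^ a * y ^ b) ^ n = x ^ (a * n) * y ^ (b * n) := fun a b n => by
    rw [(hcomm.pow_pow a b).mul_pow, pow_mul, pow_mul]
  have hsix : ∀ g : G, g ^ 6 = 1 → g ^ 2 ≠ 1 → g ^ 3 ≠ 1 → orderOf g = 6 := by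
    intro g h6 h2 h3
    refine orderOf_eq_of_pow_and_pow_div_prime (by norm_num) h6 fun p hp hp6 => ?_
    have h23 : p ∣ 2 * 3 := hp6
    rcases (Nat.Prime.dvd_mul hp).1 h23 with hp2 | hp3
    · rwa [(Nat.prime_dvd_prime_iff_eq hp Nat.prime_two).1 hp2]
    · rwa [(Nat.prime_dvd_prime_iff_eq hp Nat.prime_three).1 hp3]
  -- The pairs `(i, j)` with `x ^ i * y ^ j = 1` form a subgroup of `(ℤ / 6) ^ 2`.
  have hpow : ∀ i j n i' j' : ℕ, x ^ i * y ^ j = 1 → i * n ≡ i' [MOD 6] → j * n ≡ j' [MOD 6] →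
      x ^ i' * y ^ j' = 1 := fun i j n i' j' h hi hj => by
    rw [← hmod x hx _ _ hi, ← hmod y hy _ _ hj, ← hmul, h, one_pow]
  have hadd : ∀ i j k l : ℕ, x ^ i * y ^ j = 1 → x ^ k * y ^ l = 1 →
      x ^ (i + k) * y ^ (j + l) = 1 := fun i j k l h h' => by
    rw [pow_add, pow_add, (hcomm.pow_pow k j).mul_mul_mul_comm, h, h', one_mul]
  have hfst : ∀ i : ℕ, x ^ i * y ^ 0 = 1 → 6 ∣ i := fun i h => by
    rw [pow_zero, mul_one] at h
    exact hx ▸ orderOf_dvd_of_pow_eq_one h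
  have hsnd : ∀ j : ℕ, x ^ 0 * y ^ j = 1 → 6 ∣ j := fun j h => by
    rw [pow_zero, one_mul] at h
    exact hy ▸ orderOf_dvd_of_pow_eq_one h
  have hx6 : x ^ 6 = 1 := hx ▸ pow_orderOf_eq_one x
  have hy6 : y ^ 6 = 1 := hy ▸ pow_orderOf_eq_one y
  have h11 : ¬ x ^ 1 * y ^ 1 = 1 := fun h => hyx.2 (by
    rw [pow_one, pow_one] at h
    rw [← mul_right_inj x, h, ← pow_succ', hx6])
  have h51 : ¬ x ^ 5 * y ^ 1 = 1 := fun h => hyx.1 (by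
    rw [pow_one] at h
    rw [← mul_right_inj (x ^ 5), h, ← pow_succ, hx6])
  have hfour : ∀ i j : ℕ, ¬ x ^ (i * 2) * y ^ (j * 2) = 1 → ¬ x ^ (i * 3) * y ^ (j * 3) = 1 →
      x ^ (i + 5) * y ^ j = 1 ∨ x ^ (i + 1) * y ^ j = 1 ∨ x ^ i * y ^ (j + 5) = 1 ∨
        x ^ i * y ^ (j + 1) = 1 := by
    intro i j h2 h3
    have h6 : (x ^ i * y ^ j) ^ 6 = 1 := by
      rw [hmul, mul_comm i, mul_comm j, pow_mul, pow_mul, hx6, hy6, one_pow, one_pow, one_mul]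
    have hx5 : ∀ m : ℕ, x ^ (i + m) * y ^ j = x ^ m * (x ^ i * y ^ j) := fun m => by
      rw [add_comm, pow_add, mul_assoc]
    have hy5 : ∀ m : ℕ, x ^ i * y ^ (j + m) = x ^ i * y ^ j * y ^ m := fun m => by
      rw [pow_add, mul_assoc]
    rw [← hmul] at h2 h3
    rw [hx5, hx5, hy5, hy5]
    rcases hset _ (hsix _ h6 h2 h3) with h | h | h | h <;> rw [h]
    · exact Or.inl (by rw [← pow_succ, hx6])
    · exact Or.inr (Or.inl (by rw [pow_one, ← pow_succ', hx6]))
    · exact Or.inr (Or.inr (Or.inl (by rw [← pow_succ', hy6])))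
    · exact Or.inr (Or.inr (Or.inr (by rw [pow_one, ← pow_succ, hy6])))
  by_cases h33 : x ^ 3 * y ^ 3 = 1
  · -- Here `x ^ 5 * y ^ 2` is a fifth element of order `6`.
    have h44 : ¬ x ^ 4 * y ^ 4 = 1 := fun h =>
      h11 (hpow 7 7 1 1 1 (hadd 4 4 3 3 h h33) (by decide) (by decide))
    rcases hfour 5 2 (fun h => h44 (hpow _ _ 1 4 4 h (by decide) (by decide)))
      (fun h => absurd (hfst 3 (hpow _ _ 1 3 0 h (by decide) (by decide))) (by decide))
      with h | h | h | h
    · have h24 := hpow _ _ 2 2 4 h (by decide) (by decide)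
      exact h51 (hpow _ _ 1 5 1 (hadd 2 4 3 3 h24 h33) (by decide) (by decide))
    · exact absurd (hsnd 2 (hpow _ _ 1 0 2 h (by decide) (by decide))) (by decide)
    · exact h51 (hpow _ _ 1 5 1 h (by decide) (by decide))
    · exact absurd (hfst 4 (hpow _ _ 2 4 0 h (by decide) (by decide))) (by decide)
  · -- Here `x ^ 5 * y ^ 3` is a fifth element of order `6`.
    rcases hfour 5 3
      (fun h => absurd (hfst 4 (hpow _ _ 1 4 0 h (by decide) (by decide))) (by decide))
      (fun h => h33 (hpow _ _ 1 3 3 h (by decide) (by decide))) with h | h | h | h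
    · exact absurd (hsnd 3 (hpow _ _ 3 0 3 h (by decide) (by decide))) (by decide)
    · exact absurd (hsnd 3 (hpow _ _ 1 0 3 h (by decide) (by decide))) (by decide)
    · exact absurd (hfst 3 (hpow _ _ 3 3 0 h (by decide) (by decide))) (by decide)
    · exact absurd (hfst 3 (hpow _ _ 3 3 0 h (by decide) (by decide))) (by decide)

/-! ### Groups with exactly four elements of order divisible by ten -/

/-- `SelfCentralizingTen x` says that `x` has order `10` and that the subgroup `⟨x⟩` is normal and
equal to its own centralizer; `x`, `x ^ 3`, `x ^ 7` and `x ^ 9` are the generators of `⟨x⟩`. -/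
structure SelfCentralizingTen {G : Type*} [Group G] (x : G) : Prop where
  orderOf_eq : orderOf x = 10
  conj_mem : ∀ g : G, g * x * g⁻¹ ∈ ({x, x ^ 3, x ^ 7, x ^ 9} : Set G)
  exists_eq_pow : ∀ g : G, Commute g x → ∃ m : ℕ, g = x ^ m

theorem selfCentralizingTen_of_ncard_eq_four {G : Type*} [Group G] [Finite G]
    (hcard : ∀ p : ℕ, p.Prime → p ∣ Nat.card G → p = 2 ∨ p = 5)
    (hE : {g : G | 10 ∣ orderOf g}.ncard = 4) {x : G} (hx : orderOf x = 10) :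
    SelfCentralizingTen x := by
  have hset : ∀ g : G, 10 ∣ orderOf g → g ∈ ({x, x ^ 3, x ^ 7, x ^ 9} : Set G) := by
    have h1 : ({x, x ^ 3, x ^ 7, x ^ 9} : Set G) = {g : G | 10 ∣ orderOf g} := by
      refine Set.eq_of_subset_of_ncard_le ?_ (by rw [hE, ncard_generators_of_orderOf_eq_ten hx])
      have hpow : ∀ n : ℕ, Nat.Coprime 10 n → 10 ∣ orderOf (x ^ n) := by
        intro n hn
        rw [Nat.Coprime.orderOf_pow (hx ▸ hn), hx]
      rintro g (rfl | rfl | rfl | rfl)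
      · exact hx.symm.dvd
      all_goals exact hpow _ (by norm_num)
    intro g hg
    rw [h1]
    exact hg
  have hset' : ∀ g : G, 10 ∣ orderOf g → ∃ m : ℕ, g = x ^ m := by
    intro g hg
    rcases hset g hg with rfl | rfl | rfl | rfl
    exacts [⟨1, (pow_one _).symm⟩, ⟨3, rfl⟩, ⟨7, rfl⟩, ⟨9, rfl⟩]
  -- An element of `2`-power or `5`-power order that commutes with `x` gets order divisible by `10`
  -- when multiplied by `x ^ 2` or `x ^ 5`, and so lies in `⟨x⟩`.
  have hmul : ∀ g : G, Commute g x → ∀ n m : ℕ, orderOf (x ^ n) = m →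
      (orderOf g).Coprime m → 10 ∣ orderOf g * m → ∃ i : ℕ, g = x ^ i := by
    rintro g hg n m hn hco h10
    obtain ⟨j, hj⟩ := hset' (g * x ^ n) (by
      rwa [(hg.pow_right n).orderOf_mul_eq_mul_orderOf_of_coprime (hn.symm ▸ hco), hn])
    refine ⟨j + 9 * n, ?_⟩
    have hx10 : x ^ (10 * n) = 1 := by rw [pow_mul, ← hx, pow_orderOf_eq_one, one_pow]
    rw [pow_add, ← hj, mul_assoc, ← pow_add, show n + 9 * n = 10 * n by ring, hx10, mul_one]
  refine ⟨hx, fun g => hset _ (by rw [← hx, ← (MulAut.conj g).orderOf_eq x]; rfl), fun g hg => ?_⟩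
  by_cases hg1 : g = 1
  · exact ⟨0, by rw [hg1, pow_zero]⟩
  by_cases h2 : 2 ∣ orderOf g
  · by_cases h5 : 5 ∣ orderOf g
    · exact hset' g (Nat.Coprime.mul_dvd_of_dvd_of_dvd (by norm_num : Nat.Coprime 2 5) h2 h5)
    · refine hmul g hg 2 5 (by rw [orderOf_pow, hx]; rfl) ?_ (mul_dvd_mul_right h2 5)
      exact ((Nat.Prime.coprime_iff_not_dvd Nat.prime_five).2 h5).symm
  · have h5 : 5 ∣ orderOf g := by
      obtain ⟨p, hp, hpg⟩ := Nat.exists_prime_and_dvd (mt orderOf_eq_one_iff.1 hg1)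
      rcases hcard p hp (hpg.trans (orderOf_dvd_natCard g)) with rfl | rfl
      · exact absurd hpg h2
      · exact hpg
    refine hmul g hg 5 2 (by rw [orderOf_pow, hx]; rfl) ?_ (mul_dvd_mul_right h5 2)
    exact ((Nat.Prime.coprime_iff_not_dvd Nat.prime_two).2 h2).symm

namespace SelfCentralizingTen

variable {G : Type*} [Group G] {x : G}

/-- If every element of `G` acts on `⟨x⟩` like a power of `b`, then `x` and `b` generate `G`, since
the elements that act trivially are the powers of `x`. -/
theorem closure_eq_top (h : SelfCentralizingTen x) {b : G} {r : ℕ} (hb : b * x * b⁻¹ = x ^ r)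
    (hall : ∀ g : G, ∃ n : ℕ, g * x * g⁻¹ = x ^ (r ^ n)) : Subgroup.closure {x, b} = ⊤ := by
  refine (Subgroup.eq_top_iff' _).2 fun g => ?_
  have hxc : x ∈ Subgroup.closure {x, b} := Subgroup.subset_closure (by simp)
  have hbc : b ∈ Subgroup.closure {x, b} := Subgroup.subset_closure (by simp)
  obtain ⟨n, hn⟩ := hall g
  have hbn := conj_pow_pow hb n 1
  rw [pow_one, one_mul, ← hn] at hbn
  obtain ⟨m, hm⟩ := h.exists_eq_pow ((b ^ n)⁻¹ * g) (by
    rw [Commute, SemiconjBy, ← mul_inv_eq_iff_eq_mul]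
    calc (b ^ n)⁻¹ * g * x * ((b ^ n)⁻¹ * g)⁻¹ = (b ^ n)⁻¹ * (g * x * g⁻¹) * b ^ n := by group
      _ = x := by rw [← hbn]; group)
  rw [inv_mul_eq_iff_eq_mul] at hm
  rw [hm]
  exact mul_mem (pow_mem hbc n) (pow_mem hxc m)

theorem pow_congr (h : SelfCentralizingTen x) {m n : ℕ} (hmn : m ≡ n [MOD 10]) :
    x ^ m = x ^ n := pow_eq_pow_iff_modEq.2 (h.orderOf_eq.symm ▸ hmn)

/-- If `g` acts on `⟨x⟩` as the `r`-th power map, then `b = g ^ 5` acts in the same way, as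
`r ^ 4 = 1` modulo `10`, and moreover `b ^ k` is one of the two fifth powers `1` and `x ^ 5` in
`⟨x⟩`. -/
theorem exists_metacyclicPair (h : SelfCentralizingTen x) {r k : ℕ}
    (hr : orderOf (r : ZMod 10) = k) (hk : 0 < k) (hr5 : r ^ 5 ≡ r [MOD 10])
    {g : G} (hg : g * x * g⁻¹ = x ^ r) (hall : ∀ g : G, ∃ n : ℕ, g * x * g⁻¹ = x ^ (r ^ n)) :
    ∃ b : G, MetacyclicPair x b r k 0 ∨ MetacyclicPair x b r k 5 := by
  have hb : g ^ 5 * x * (g ^ 5)⁻¹ = x ^ r := by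
    have := conj_pow_pow hg 5 1
    rwa [pow_one, one_mul, h.pow_congr hr5] at this
  have hrk : r ^ k ≡ 1 [MOD 10] := by
    rw [← ZMod.natCast_eq_natCast_iff, Nat.cast_pow, Nat.cast_one, ← hr, pow_orderOf_eq_one]
  obtain ⟨m, hm⟩ := h.exists_eq_pow (g ^ k) (by
    have := conj_pow_pow hg k 1
    rw [one_mul, h.pow_congr hrk, pow_one, mul_inv_eq_iff_eq_mul] at this
    exact this)
  have hcl := h.closure_eq_top hb hall
  have hbk : (g ^ 5) ^ k = x ^ (m * 5) := by rw [← pow_mul, mul_comm, pow_mul, hm, pow_mul]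
  rcases Nat.even_or_odd' m with ⟨t, rfl | rfl⟩
  · refine ⟨g ^ 5, Or.inl ⟨h.orderOf_eq, hb, ?_, hcl, hr, hk⟩⟩
    rw [hbk]
    exact h.pow_congr (by unfold Nat.ModEq; omega)
  · refine ⟨g ^ 5, Or.inr ⟨h.orderOf_eq, hb, ?_, hcl, hr, hk⟩⟩
    rw [hbk]
    exact h.pow_congr (by unfold Nat.ModEq; omega)

theorem orderOf_seven : orderOf ((7 : ℕ) : ZMod 10) = 4 := by
  rw [orderOf_eq_iff (by norm_num)]
  decide

theorem orderOf_nine : orderOf ((9 : ℕ) : ZMod 10) = 2 := by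
  rw [orderOf_eq_iff (by norm_num)]
  decide

/-- The five cases are told apart by the group of automorphisms of `⟨x⟩` that `G` induces, of order
`1`, `2` or `4`, and by whether it lifts to a complement of `⟨x⟩`. -/
theorem exists_cases (h : SelfCentralizingTen x) :
    ∃ b : G, MetacyclicPair x b 1 1 0 ∨ MetacyclicPair x b 9 2 0 ∨ MetacyclicPair x b 9 2 5 ∨
      MetacyclicPair x b 7 4 0 ∨ MetacyclicPair x b 7 4 5 := by
  by_cases h7 : ∃ g : G, g * x * g⁻¹ = x ^ 7
  · obtain ⟨g, hg⟩ := h7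
    obtain ⟨b, hb⟩ := h.exists_metacyclicPair orderOf_seven (by norm_num) (by decide) hg fun g => by
      rcases h.conj_mem g with hg | hg | hg | hg
      · exact ⟨0, by rw [hg, pow_zero, pow_one]⟩
      · exact ⟨3, by rw [hg]; exact h.pow_congr (by decide)⟩
      · exact ⟨1, by rw [hg, pow_one]⟩
      · exact ⟨2, by rw [hg]; exact h.pow_congr (by decide)⟩
    exact ⟨b, by tauto⟩
  have h3 : ¬ ∃ g : G, g * x * g⁻¹ = x ^ 3 := by
    rintro ⟨g, hg⟩
    -- Modulo `10`, the cube of `3` is `7`.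
    refine h7 ⟨g ^ 3, ?_⟩
    have := conj_pow_pow hg 3 1
    rw [pow_one] at this
    rw [this]
    exact h.pow_congr (by decide)
  by_cases h9 : ∃ g : G, g * x * g⁻¹ = x ^ 9
  · obtain ⟨g, hg⟩ := h9
    obtain ⟨b, hb⟩ := h.exists_metacyclicPair orderOf_nine (by norm_num) (by decide) hg fun g => by
      rcases h.conj_mem g with hg | hg | hg | hg
      · exact ⟨0, by rw [hg, pow_zero, pow_one]⟩
      · exact absurd ⟨g, hg⟩ h3
      · exact absurd ⟨g, hg⟩ h7
      · exact ⟨1, by rw [hg, pow_one]⟩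
    exact ⟨b, by tauto⟩
  · have hone : (1 : G) * x * 1⁻¹ = x ^ 1 := by group
    refine ⟨1, Or.inl ⟨h.orderOf_eq, hone, by simp, ?_, by simp, one_pos⟩⟩
    refine h.closure_eq_top hone fun g => ⟨0, ?_⟩
    rw [pow_zero, pow_one]
    rcases h.conj_mem g with hg | hg | hg | hg
    · exact hg
    · exact absurd ⟨g, hg⟩ h3
    · exact absurd ⟨g, hg⟩ h7
    · exact absurd ⟨g, hg⟩ h9

end SelfCentralizingTen

theorem card_eq_five_or_exists_selfCentralizingTen {G : Type*} [Group G] [Finite G]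
    (hE : (endVertices G).ncard = 4) :
    Nat.card G = 5 ∨ ∃ x : G, SelfCentralizingTen x := by
  by_cases h1 : ∀ p q : ℕ, p.Prime → q.Prime → p ∣ Nat.card G → q ∣ Nat.card G → p = q
  · exact Or.inl (card_eq_of_ncard_endVertices_eq h1 hE)
  push Not at h1
  obtain ⟨p, q, hp, hq, hpG, hqG, hpq⟩ := h1
  right
  have hord : ∀ g ∈ endVertices G, orderOf g = 6 ∨ orderOf g = 10 := by
    intro g hg
    have h12 := orderOf_ne_twelve hE hg
    have hle := totient_orderOf_le_ncard_endVertices hg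
    have hg' := (mem_endVertices_iff.1 hg).2
    have := eq_of_totient_le_four (orderOf_pos g).ne' hp hq hpq (hg' p hp hpG) (hg' q hq hqG)
      (hE ▸ hle)
    tauto
  obtain ⟨x, hx⟩ : (endVertices G).Nonempty :=
    Set.nonempty_of_ncard_ne_zero (by rw [hE]; norm_num)
  -- End vertices have orders with the same prime divisors, so all have the order of `x`.
  have hiff : ∀ g, g ∈ endVertices G ↔ orderOf x ∣ orderOf g := by
    intro g
    rw [mem_endVertices_iff]
    have hx' := mem_endVertices_iff.1 hx
    constructor
    · rintro ⟨-, hg⟩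
      have h2 : 2 ∣ Nat.card G := by
        refine dvd_trans ?_ (orderOf_dvd_natCard x)
        rcases hord x hx with h | h <;> rw [h] <;> norm_num
      rcases hord x hx with h | h <;> rw [h]
      · have h3 : 3 ∣ Nat.card G := dvd_trans (by rw [h]; norm_num) (orderOf_dvd_natCard x)
        exact Nat.Coprime.mul_dvd_of_dvd_of_dvd (by norm_num : Nat.Coprime 2 3)
          (hg 2 Nat.prime_two h2) (hg 3 Nat.prime_three h3)
      · have h5 : 5 ∣ Nat.card G := dvd_trans (by rw [h]; norm_num) (orderOf_dvd_natCard x)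
        exact Nat.Coprime.mul_dvd_of_dvd_of_dvd (by norm_num : Nat.Coprime 2 5)
          (hg 2 Nat.prime_two h2) (hg 5 Nat.prime_five h5)
    · intro hg
      refine ⟨?_, fun p hp hpG => (hx'.2 p hp hpG).trans hg⟩
      rintro rfl
      rw [orderOf_one, Nat.dvd_one, orderOf_eq_one_iff] at hg
      exact hx'.1 hg
  rcases hord x hx with h | h
  · exfalso
    refine ncard_setOf_orderOf_eq_six_ne_four (G := G) ?_
    rw [← hE]
    congr 1
    ext g
    refine ⟨fun hg => (hiff g).2 (h.trans (Eq.symm hg)).dvd, fun hg => ?_⟩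
    have h6 := (hiff g).1 hg
    rcases hord g hg with h' | h'
    · exact h'
    · rw [h, h'] at h6
      omega
  · refine ⟨x, selfCentralizingTen_of_ncard_eq_four (fun p hp hpG => ?_) ?_ h⟩
    · have h10 : p ∣ 2 * 5 := by
        have := (mem_endVertices_iff.1 hx).2 p hp hpG
        rwa [h] at this
      rcases (Nat.Prime.dvd_mul hp).1 h10 with h2 | h5
      · exact Or.inl ((Nat.prime_dvd_prime_iff_eq hp Nat.prime_two).1 h2)
      · exact Or.inr ((Nat.prime_dvd_prime_iff_eq hp Nat.prime_five).1 h5)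
    · rw [← hE]
      congr 1
      ext g
      rw [hiff, h]
      rfl

/-! ### The six groups -/

open SelfCentralizingTen in
theorem metacyclicPair_dihedralGroup :
    MetacyclicPair (DihedralGroup.r 1 : DihedralGroup 10) (DihedralGroup.sr 0) 9 2 0 where
  orderOf_eq := DihedralGroup.orderOf_r_one
  conj_eq := by decide
  pow_eq := by decide
  closure_eq := by
    refine (Subgroup.eq_top_iff' _).2 fun g => ?_
    have hx : (DihedralGroup.r 1 : DihedralGroup 10) ∈
        Subgroup.closure {DihedralGroup.r 1, DihedralGroup.sr 0} :=
      Subgroup.subset_closure (by simp)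
    have hb : (DihedralGroup.sr 0 : DihedralGroup 10) ∈
        Subgroup.closure {DihedralGroup.r 1, DihedralGroup.sr 0} :=
      Subgroup.subset_closure (by simp)
    obtain ⟨i, j, rfl⟩ : ∃ (i : Fin 10) (j : Fin 2),
        g = DihedralGroup.r 1 ^ (i : ℕ) * DihedralGroup.sr 0 ^ (j : ℕ) := by
      revert g
      decide
    exact mul_mem (pow_mem hx _) (pow_mem hb _)
  orderOf_exponent := orderOf_nine
  exponent_pos := by norm_num

open SelfCentralizingTen in
theorem metacyclicPair_quaternionGroup :
    MetacyclicPair (QuaternionGroup.a 1 : QuaternionGroup 5) (QuaternionGroup.xa 0) 9 2 5 where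
  orderOf_eq := QuaternionGroup.orderOf_a_one
  conj_eq := by decide
  pow_eq := by decide
  closure_eq := by
    refine (Subgroup.eq_top_iff' _).2 fun g => ?_
    have hx : (QuaternionGroup.a 1 : QuaternionGroup 5) ∈
        Subgroup.closure {QuaternionGroup.a 1, QuaternionGroup.xa 0} :=
      Subgroup.subset_closure (by simp)
    have hb : (QuaternionGroup.xa 0 : QuaternionGroup 5) ∈
        Subgroup.closure {QuaternionGroup.a 1, QuaternionGroup.xa 0} :=
      Subgroup.subset_closure (by simp)
    obtain ⟨i, j, rfl⟩ : ∃ (i : Fin 10) (j : Fin 2),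
        g = QuaternionGroup.a 1 ^ (i : ℕ) * QuaternionGroup.xa 0 ^ (j : ℕ) := by
      revert g
      decide
    exact mul_mem (pow_mem hx _) (pow_mem hb _)
  orderOf_exponent := orderOf_nine
  exponent_pos := by norm_num

theorem metacyclicPair_zmod :
    MetacyclicPair (Multiplicative.ofAdd (1 : ZMod 10)) 1 1 1 0 where
  orderOf_eq := by rw [orderOf_ofAdd_eq_addOrderOf, ZMod.addOrderOf_one]
  conj_eq := by simp
  pow_eq := by simp
  closure_eq := by
    refine (Subgroup.eq_top_iff' _).2 fun g => ?_
    have hx : Multiplicative.ofAdd (1 : ZMod 10) ∈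
        Subgroup.closure {Multiplicative.ofAdd (1 : ZMod 10), 1} :=
      Subgroup.subset_closure (by simp)
    obtain ⟨i, rfl⟩ : ∃ i : Fin 10, g = Multiplicative.ofAdd (1 : ZMod 10) ^ (i : ℕ) := by
      revert g
      decide
    exact pow_mem hx _
  orderOf_exponent := by simp
  exponent_pos := one_pos

/-- The translation `t ↦ t + 1` of the affine line over `𝔽₅`. -/
def affineTranslation : AffineGroupOne (ZMod 5) := AffineEquiv.constVAdd (ZMod 5) (ZMod 5) 1

/-- The homothety `t ↦ 2 * t` of the affine line over `𝔽₅`; `2` generates `𝔽₅ˣ`. -/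
def affineDoubling : AffineGroupOne (ZMod 5) :=
  (LinearEquiv.smulOfUnit (⟨2, 3, by decide, by decide⟩ : (ZMod 5)ˣ)).toAffineEquiv

theorem affineTranslation_apply (t : ZMod 5) : affineTranslation t = 1 + t := rfl

theorem affineDoubling_apply (t : ZMod 5) : affineDoubling t = 2 * t := rfl

theorem affineTranslation_pow_apply (n : ℕ) (t : ZMod 5) :
    (affineTranslation ^ n) t = n + t := by
  induction n with
  | zero => simp
  | succ n ih =>
    rw [pow_succ', AffineEquiv.mul_def, AffineEquiv.trans_apply, ih, affineTranslation_apply]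
    push_cast
    ring

theorem affineDoubling_pow_apply (n : ℕ) (t : ZMod 5) :
    (affineDoubling ^ n) t = 2 ^ n * t := by
  induction n with
  | zero => simp
  | succ n ih =>
    rw [pow_succ', AffineEquiv.mul_def, AffineEquiv.trans_apply, ih, affineDoubling_apply]
    ring

theorem affineGroupOne_exists_eq (f : AffineGroupOne (ZMod 5)) :
    ∃ i j : ℕ, f = affineTranslation ^ i * affineDoubling ^ j := by
  have hf : ∀ t : ZMod 5, f t = f.linear 1 * t + f 0 := fun t => by
    have h1 := f.map_vadd 0 t
    have h2 := f.linear.map_smul t 1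
    simp only [vadd_eq_add, add_zero, smul_eq_mul, mul_one] at h1 h2
    rw [h1, h2, mul_comm]
  have h0 : f.linear 1 ≠ 0 := by
    rw [Ne, LinearEquiv.map_eq_zero_iff]
    decide
  obtain ⟨j, hj⟩ := (by decide : ∀ u : ZMod 5, u ≠ 0 → ∃ j : Fin 4, u = 2 ^ (j : ℕ)) _ h0
  refine ⟨(f 0).val, j, AffineEquiv.ext fun t => ?_⟩
  rw [AffineEquiv.mul_def, AffineEquiv.trans_apply, affineDoubling_pow_apply,
    affineTranslation_pow_apply, ZMod.natCast_zmod_val, hf, hj, add_comm]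

theorem affineTranslation_pow_five : affineTranslation ^ 5 = 1 :=
  AffineEquiv.ext fun t => by
    rw [affineTranslation_pow_apply]
    revert t
    decide

theorem affineDoubling_pow_four : affineDoubling ^ 4 = 1 :=
  AffineEquiv.ext fun t => by
    rw [affineDoubling_pow_apply]
    revert t
    decide

theorem affineDoubling_conj :
    affineDoubling * affineTranslation * affineDoubling⁻¹ = affineTranslation ^ 2 := by
  rw [mul_inv_eq_iff_eq_mul]
  refine AffineEquiv.ext fun t => ?_
  rw [AffineEquiv.mul_def, AffineEquiv.mul_def, AffineEquiv.trans_apply, AffineEquiv.trans_apply,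
    affineTranslation_pow_apply, affineDoubling_apply, affineDoubling_apply,
    affineTranslation_apply]
  revert t
  decide

theorem affineTranslation_pow_ne_one {n : ℕ} (hn : (n : ZMod 5) ≠ 0) :
    affineTranslation ^ n ≠ 1 := fun h => hn (by
  have := affineTranslation_pow_apply n 0
  rw [h] at this
  simpa using this.symm)

theorem orderOf_eq_ten {G : Type*} [Group G] {x : G} (h10 : x ^ 10 = 1) (h2 : x ^ 2 ≠ 1)
    (h5 : x ^ 5 ≠ 1) : orderOf x = 10 := by
  refine orderOf_eq_of_pow_and_pow_div_prime (by norm_num) h10 fun p hp hp10 => ?_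
  have h25 : p ∣ 2 * 5 := hp10
  rcases (Nat.Prime.dvd_mul hp).1 h25 with hp2 | hp5
  · rwa [(Nat.prime_dvd_prime_iff_eq hp Nat.prime_two).1 hp2]
  · rwa [(Nat.prime_dvd_prime_iff_eq hp Nat.prime_five).1 hp5]

open SelfCentralizingTen in
theorem metacyclicPair_affineGroupOne_prod :
    MetacyclicPair
      ((affineTranslation, Multiplicative.ofAdd 1) :
        AffineGroupOne (ZMod 5) × Multiplicative (ZMod 2))
      (affineDoubling, 1) 7 4 0 where
  orderOf_eq := by
    refine orderOf_eq_ten (Prod.ext ?_ (by decide)) (fun h => ?_) (fun h => ?_)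
    · change affineTranslation ^ (5 * 2) = 1
      rw [pow_mul, affineTranslation_pow_five, one_pow]
    · exact affineTranslation_pow_ne_one (by decide) (congrArg Prod.fst h)
    · exact absurd (congrArg Prod.snd h) (by decide)
  conj_eq := by
    refine Prod.ext ?_ (by decide)
    change affineDoubling * affineTranslation * affineDoubling⁻¹ = affineTranslation ^ (5 + 2)
    rw [affineDoubling_conj, pow_add, affineTranslation_pow_five, one_mul]
  pow_eq := Prod.ext affineDoubling_pow_four (by decide)
  closure_eq := by
    refine (Subgroup.eq_top_iff' _).2 ?_
    rintro ⟨f, e⟩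
    obtain ⟨i, j, rfl⟩ := affineGroupOne_exists_eq f
    obtain ⟨m, rfl⟩ : ∃ m : Fin 2, e = Multiplicative.ofAdd 1 ^ (m : ℕ) := by
      revert e
      decide
    -- With `x` the given element of order ten, `x ^ 6` and `x ^ 5` are its components of order
    -- five and two.
    have hx : ((affineTranslation, Multiplicative.ofAdd 1) :
        AffineGroupOne (ZMod 5) × Multiplicative (ZMod 2)) ∈
          Subgroup.closure {(affineTranslation, Multiplicative.ofAdd 1), (affineDoubling, 1)} :=
      Subgroup.subset_closure (by simp)
    have hb : ((affineDoubling, 1) : AffineGroupOne (ZMod 5) × Multiplicative (ZMod 2)) ∈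
          Subgroup.closure {(affineTranslation, Multiplicative.ofAdd 1), (affineDoubling, 1)} :=
      Subgroup.subset_closure (by simp)
    convert mul_mem (mul_mem (pow_mem (pow_mem hx 6) i) (pow_mem hb j)) (pow_mem (pow_mem hx 5) m)
      using 1
    refine Prod.ext ?_ ?_
    · change affineTranslation ^ i * affineDoubling ^ j =
        (affineTranslation ^ (5 + 1)) ^ i * affineDoubling ^ j * (affineTranslation ^ 5) ^ (m : ℕ)
      rw [pow_add, affineTranslation_pow_five, one_mul, pow_one, one_pow, mul_one]
    · change Multiplicative.ofAdd (1 : ZMod 2) ^ (m : ℕ) =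
        (Multiplicative.ofAdd (1 : ZMod 2) ^ 6) ^ i * 1 ^ j *
          (Multiplicative.ofAdd (1 : ZMod 2) ^ 5) ^ (m : ℕ)
      rw [show Multiplicative.ofAdd (1 : ZMod 2) ^ 6 = 1 by decide,
        show Multiplicative.ofAdd (1 : ZMod 2) ^ 5 = Multiplicative.ofAdd 1 by decide, one_pow,
        one_pow, one_mul, one_mul]
  orderOf_exponent := orderOf_seven
  exponent_pos := by norm_num

namespace MetacyclicGroup

/-- The generator `a` of order five. -/
def a : MetacyclicGroup := PresentedGroup.of 0

/-- The generator `b` of order eight. -/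
def b : MetacyclicGroup := PresentedGroup.of 1

theorem a_pow_five : a ^ 5 = 1 :=
  PresentedGroup.one_of_mem (rels := metacyclicRelators) (x := FreeGroup.of 0 ^ 5)
    (by simp [metacyclicRelators])

theorem b_pow_eight : b ^ 8 = 1 :=
  PresentedGroup.one_of_mem (rels := metacyclicRelators) (x := FreeGroup.of 1 ^ 8)
    (by simp [metacyclicRelators])

theorem b_conj_a : b * a * b⁻¹ = a ^ 2 :=
  mul_inv_eq_one.1 (PresentedGroup.one_of_mem (rels := metacyclicRelators)
    (x := FreeGroup.of 1 * FreeGroup.of 0 * (FreeGroup.of 1)⁻¹ * (FreeGroup.of 0 ^ 2)⁻¹)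
    (by simp [metacyclicRelators]))

/-- The homomorphism to a group in which images of `a` and `b` that satisfy the relations are
given. -/
def lift {H : Type*} [Group H] (u v : H) (hu : u ^ 5 = 1) (hv : v ^ 8 = 1)
    (huv : v * u * v⁻¹ = u ^ 2) : MetacyclicGroup →* H :=
  PresentedGroup.toGroup (f := ![u, v]) (by
    rintro w (rfl | rfl | rfl)
    · simpa using hu
    · simpa using hv
    · simp [huv])

theorem lift_a {H : Type*} [Group H] {u v : H} (hu : u ^ 5 = 1) (hv : v ^ 8 = 1)
    (huv : v * u * v⁻¹ = u ^ 2) : lift u v hu hv huv a = u :=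
  PresentedGroup.toGroup.of _

theorem lift_b {H : Type*} [Group H] {u v : H} (hu : u ^ 5 = 1) (hv : v ^ 8 = 1)
    (huv : v * u * v⁻¹ = u ^ 2) : lift u v hu hv huv b = v :=
  PresentedGroup.toGroup.of _

/-- Seen in the action of the group on the affine line over `𝔽₅`. -/
theorem a_pow_two_ne_one : a ^ 2 ≠ 1 := fun h => by
  have h1 := congrArg (lift affineTranslation affineDoubling affineTranslation_pow_five
    (by rw [show 8 = 4 * 2 from rfl, pow_mul, affineDoubling_pow_four, one_pow])
    affineDoubling_conj) h
  rw [map_pow, lift_a, map_one] at h1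
  exact affineTranslation_pow_ne_one (by decide) h1

/-- Seen in the quotient by `⟨a⟩`, which is cyclic of order eight. -/
theorem b_pow_four_ne_one : b ^ 4 ≠ 1 := fun h => by
  have hv : (Multiplicative.ofAdd 1 : Multiplicative (ZMod 8)) ^ 8 = 1 := by decide
  have h1 := congrArg (lift 1 (Multiplicative.ofAdd 1) (one_pow 5) hv (by simp)) h
  rw [map_pow, lift_b] at h1
  exact absurd (h1.trans (map_one _)) (by decide)

theorem b_pow_four_commute : Commute a (b ^ 4) := by
  have h1 := conj_pow_pow b_conj_a 4 1
  rw [pow_one, mul_inv_eq_iff_eq_mul, show 1 * 2 ^ 4 = 5 * 3 + 1 from rfl, pow_succ a, pow_mul a,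
    a_pow_five, one_pow, one_mul] at h1
  exact h1.symm

theorem mul_pow_eq (n : ℕ) : (a * b ^ 4) ^ n = a ^ n * b ^ (4 * n) := by
  rw [b_pow_four_commute.mul_pow, pow_mul]

theorem closure_eq_top : Subgroup.closure {a, b} = ⊤ := by
  rw [← PresentedGroup.closure_range_of metacyclicRelators]
  congr 1
  ext g
  simp [Fin.exists_fin_two, a, b, eq_comm]

open SelfCentralizingTen in
theorem metacyclicPair : MetacyclicPair (a * b ^ 4) b 7 4 5 where
  orderOf_eq := by
    refine orderOf_eq_ten ?_ ?_ ?_ <;> rw [mul_pow_eq]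
    · rw [show 4 * 10 = 8 * 5 from rfl, show 10 = 5 * 2 from rfl, pow_mul, pow_mul, a_pow_five,
        b_pow_eight, one_pow, one_pow, one_mul]
    · rw [show 4 * 2 = 8 from rfl, b_pow_eight, mul_one]
      exact a_pow_two_ne_one
    · rw [a_pow_five, one_mul, show 4 * 5 = 8 * 2 + 4 from rfl, pow_add, pow_mul, b_pow_eight,
        one_pow, one_mul]
      exact b_pow_four_ne_one
  conj_eq := by
    rw [mul_pow_eq, show 4 * 7 = 8 * 3 + 4 from rfl, pow_add b, pow_mul b, b_pow_eight, one_pow,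
      one_mul, show 7 = 5 + 2 from rfl, pow_add a, a_pow_five, one_mul, ← b_conj_a]
    group
  pow_eq := by
    rw [mul_pow_eq, a_pow_five, one_mul, show 4 * 5 = 8 * 2 + 4 from rfl, pow_add b, pow_mul b,
      b_pow_eight, one_pow, one_mul]
  closure_eq := by
    rw [eq_top_iff, ← closure_eq_top, Subgroup.closure_le]
    have hx : a * b ^ 4 ∈ Subgroup.closure {a * b ^ 4, b} := Subgroup.subset_closure (by simp)
    have hb : b ∈ Subgroup.closure {a * b ^ 4, b} := Subgroup.subset_closure (by simp)
    rintro g (rfl | rfl)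
    · have h1 := mul_mem hx (inv_mem (pow_mem hb 4))
      rwa [mul_inv_cancel_right] at h1
    · exact hb
  orderOf_exponent := orderOf_seven
  exponent_pos := by norm_num

end MetacyclicGroup

/-- `DihedralGroup 10` is the dihedral group of order 20, and `QuaternionGroup 5` is the dicyclic
group `⟨a, x ∣ a ^ 10 = 1, x ^ 2 = a ^ 5, x⁻¹ * a * x = a⁻¹⟩` of order 20. -/
theorem theorem3p4 (G : Type*) [Group G] [Finite G] :
    (endVertices G).ncard = 4 ↔
      (Nonempty (G ≃* Multiplicative (ZMod 5)) ∨
        Nonempty (G ≃* Multiplicative (ZMod 10)) ∨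
        Nonempty (G ≃* DihedralGroup 10) ∨
        Nonempty (G ≃* QuaternionGroup 5) ∨
        Nonempty (G ≃* AffineGroupOne (ZMod 5) × Multiplicative (ZMod 2)) ∨
        Nonempty (G ≃* MetacyclicGroup)) := by
  have h5 : Nat.card (Multiplicative (ZMod 5)) = 5 := Nat.card_zmod 5
  constructor
  · intro hE
    rcases card_eq_five_or_exists_selfCentralizingTen hE with hG | ⟨x, hx⟩
    · have := Fact.mk Nat.prime_five
      exact Or.inl ⟨mulEquivOfPrimeCardEq hG h5⟩
    · obtain ⟨b, h | h | h | h | h⟩ := hx.exists_cases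
      · exact Or.inr (Or.inl (h.nonempty_mulEquiv metacyclicPair_zmod))
      · exact Or.inr (Or.inr (Or.inl (h.nonempty_mulEquiv metacyclicPair_dihedralGroup)))
      · exact Or.inr (Or.inr (Or.inr (Or.inl
          (h.nonempty_mulEquiv metacyclicPair_quaternionGroup))))
      · exact Or.inr (Or.inr (Or.inr (Or.inr (Or.inl
          (h.nonempty_mulEquiv metacyclicPair_affineGroupOne_prod)))))
      · exact Or.inr (Or.inr (Or.inr (Or.inr (Or.inr
          (h.nonempty_mulEquiv MetacyclicGroup.metacyclicPair)))))
  · rintro (⟨⟨e⟩⟩ | ⟨⟨e⟩⟩ | ⟨⟨e⟩⟩ | ⟨⟨e⟩⟩ | ⟨⟨e⟩⟩ | ⟨⟨e⟩⟩)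
    · exact ncard_endVertices_of_card_prime Nat.prime_five ((Nat.card_congr e.toEquiv).trans h5)
    · exact (metacyclicPair_zmod.map e.symm).ncard_endVertices
    · exact (metacyclicPair_dihedralGroup.map e.symm).ncard_endVertices
    · exact (metacyclicPair_quaternionGroup.map e.symm).ncard_endVertices
    · exact (metacyclicPair_affineGroupOne_prod.map e.symm).ncard_endVertices
    · exact (MetacyclicGroup.metacyclicPair.map e.symm).ncard_endVertices
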